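/- Let $k>0$, $\beta>0$, $\beta_r\ge 0$ and $0<T_\infty<T_d$ be real constants, let $a_0,\ell>0$ and let $V_0>\ell a_0^2$. Let $$\mathcal V_{a_0,\ell,V_0}=\Big\{a\in W^{1,\infty}(0,\ell)\ :\ a\ge a_0 \text{ a.e. in } (0,\ell),\ \int_0^\ell a(x)^2\,dx\le V_0\Big\},$$ and for $a\in\mathcal V_{a_0,\ell,V_0}$ let $F(a)=-k\pi\, a(0)^2\, T'(0)$, where $T\in H^1(0,\ell)$ is the unique solution of $$(a^2T')'=\beta\, a\sqrt{1+a'^2}\,(T-T_\infty)\ \text{ in }(0,\ell),\qquad T(0)=T_d,\qquad T'(\ell)=-\beta_r\,(T(\ell)-T_\infty).$$ Then the problem of maximizing $F$ over $\mathcal V_{a_0,\ell,V_0}$ has no solution, and $$\sup_{a\in\mathcal V_{a_0,\ell,V_0}}F(a)=+\infty.$$ -/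

import Mathlib

open MeasureTheory Set
open scoped ContDiff ENNReal

/-- `g` is the weak (distributional) derivative of `f` on the interval `(0, ℓ)`; both functions are
integrable there. -/
def HasWeakDeriv (ℓ : ℝ) (f g : ℝ → ℝ) : Prop :=
  IntegrableOn f (Ioo 0 ℓ) ∧ IntegrableOn g (Ioo 0 ℓ) ∧
    ∀ φ : ℝ → ℝ, ContDiff ℝ ∞ φ → HasCompactSupport φ → tsupport φ ⊆ Ioo 0 ℓ →
      ∫ x in Ioo 0 ℓ, f x * deriv φ x = - ∫ x in Ioo 0 ℓ, g x * φ x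

/-- `f` belongs to the Sobolev space `W^{1,p}(0, ℓ)`. In dimension one every class of `W^{1,p}(0, ℓ)`
has exactly one representative that is continuous on `[0, ℓ]`; elements are given by this
representative, so that the endpoint values `f 0` and `f ℓ` make sense. Values of `f` outside
`[0, ℓ]` are irrelevant. -/
structure MemSobolev (p : ℝ≥0∞) (ℓ : ℝ) (f : ℝ → ℝ) : Prop where
  continuousOn : ContinuousOn f (Icc 0 ℓ)
  memLp : MemLp f p (volume.restrict (Ioo 0 ℓ))
  exists_weakDeriv : ∃ g : ℝ → ℝ, MemLp g p (volume.restrict (Ioo 0 ℓ)) ∧ HasWeakDeriv ℓ f g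

open Classical in
/-- The weak derivative on `(0, ℓ)` (unique almost everywhere), and `0` if there is none. -/
noncomputable def weakDeriv (ℓ : ℝ) (f : ℝ → ℝ) : ℝ → ℝ :=
  if h : ∃ g : ℝ → ℝ, HasWeakDeriv ℓ f g then h.choose else 0

/-- `T ∈ H¹(0, ℓ)` solves the fin equation with radius `a`:
`(a² T')' = β a √(1 + a'²) (T - T∞)` on `(0, ℓ)` in the sense of distributions, `T(0) = T_d` and
`T'(ℓ) = - β_r (T(ℓ) - T∞)`. For an admissible radius `a`, such a `T` is of class `C¹` on `[0, ℓ]`,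
so that the endpoint values of `T'` are one-sided derivatives. -/
structure IsTemperature (ℓ β βr Td Tinf : ℝ) (a T : ℝ → ℝ) : Prop where
  memSobolev : MemSobolev 2 ℓ T
  equation : HasWeakDeriv ℓ (fun x => a x ^ 2 * weakDeriv ℓ T x)
    (fun x => β * (a x * √(1 + weakDeriv ℓ a x ^ 2)) * (T x - Tinf))
  inlet : T 0 = Td
  tip : HasDerivWithinAt T (-βr * (T ℓ - Tinf)) (Icc 0 ℓ) ℓ

open Classical in
/-- The inlet heat flux `F(a) = - k π a(0)² T'(0)`, where `T` is the solution of the fin equation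
with radius `a` (unique on `[0, ℓ]`). -/
noncomputable def heatFlux (ℓ k β βr Td Tinf : ℝ) (a : ℝ → ℝ) : ℝ :=
  if h : ∃ T : ℝ → ℝ, IsTemperature ℓ β βr Td Tinf a T then
    -k * Real.pi * a 0 ^ 2 * derivWithin h.choose (Icc 0 ℓ) 0
  else 0

/-- `vol(a) = ∫₀^ℓ a(x)² dx`. -/
noncomputable def finVol (ℓ : ℝ) (a : ℝ → ℝ) : ℝ := ∫ x in Ioo 0 ℓ, a x ^ 2

/-- The admissible radii: `a ∈ W^{1,∞}(0, ℓ)`, `a ≥ a₀` almost everywhere and `vol(a) ≤ V₀`. -/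
def volClass (a₀ ℓ V₀ : ℝ) : Set (ℝ → ℝ) :=
  {a | MemSobolev ∞ ℓ a ∧ (∀ᵐ x ∂(volume.restrict (Ioo 0 ℓ)), a₀ ≤ a x) ∧ finVol ℓ a ≤ V₀}

/-! The flux is governed by lateral area, which a steep profile makes large at almost no cost in
volume. For a `C¹` positive radius put `q = -a² T' / (T - Tinf)`. The fin equation becomes the
Riccati equation `q' = q² / a² - β a √(1 + a'²)` with `q(ℓ) = βr a(ℓ)²`, and the flux is `k π (Td -
Tinf) q(0)` (`heatFlux_eq_of_riccati`).

Take the flare `a = a₀ + B exp(-n x)`. For `2 n ≥ β` the function `p = β/4 (a² - a(ℓ)²)` is a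
backward subsolution, so `q(0) ≥ p(0)` (`le_riccati_solution`, `le_heatFlux_flare`). With `B` fixed
and `n` large, `p(0)` is at least of order `B²`, while the volume exceeds `ℓ a₀²` by at most `(2 a₀
B + B²) / n`. Hence the flux is unbounded (`exists_lt_heatFlux`), which excludes a maximizer. -/

/-! ### Weak derivatives on an interval. -/

/-- The integral over `(0, ℓ)` of a function supported there is its integral over the line. -/
theorem setIntegral_mul_eq_integral_of_tsupport_subset {s : Set ℝ} {f φ : ℝ → ℝ}
    (hφ : tsupport φ ⊆ s) : ∫ x in s, f x * φ x = ∫ x, φ x • f x := by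
  rw [setIntegral_eq_integral_of_forall_compl_eq_zero]
  · simp [mul_comm]
  · intro x hx
    rw [image_eq_zero_of_notMem_tsupport (fun h => hx (hφ h)), mul_zero]

/-- Weak derivatives are unique almost everywhere. -/
theorem HasWeakDeriv.ae_eq {ℓ : ℝ} {f g₁ g₂ : ℝ → ℝ} (h₁ : HasWeakDeriv ℓ f g₁)
    (h₂ : HasWeakDeriv ℓ f g₂) : ∀ᵐ x ∂(volume.restrict (Ioo 0 ℓ)), g₁ x = g₂ x := by
  rw [ae_restrict_iff' measurableSet_Ioo]
  have key := isOpen_Ioo.ae_eq_zero_of_integral_contDiff_smul_eq_zero (U := Ioo 0 ℓ)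
    (μ := volume) (f := fun x => g₁ x - g₂ x) (h₁.2.1.sub h₂.2.1).locallyIntegrableOn ?_
  · filter_upwards [key] with x hx hxU using sub_eq_zero.1 (hx hxU)
  · intro φ hφ hc hs
    rw [← setIntegral_mul_eq_integral_of_tsupport_subset hs]
    have e := (h₁.2.2 φ hφ hc hs).symm.trans (h₂.2.2 φ hφ hc hs)
    obtain ⟨C, hC⟩ := hφ.continuous.bounded_above_of_compact_support hc
    have i₁ : Integrable (fun x => g₁ x * φ x) (volume.restrict (Ioo 0 ℓ)) :=
      h₁.2.1.mul_bdd hφ.continuous.aestronglyMeasurable (.of_forall hC)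
    have i₂ : Integrable (fun x => g₂ x * φ x) (volume.restrict (Ioo 0 ℓ)) :=
      h₂.2.1.mul_bdd hφ.continuous.aestronglyMeasurable (.of_forall hC)
    simp_rw [sub_mul]
    rw [integral_sub i₁ i₂]
    linarith

theorem HasWeakDeriv.congr_ae {ℓ : ℝ} {f g f' g' : ℝ → ℝ} (h : HasWeakDeriv ℓ f g)
    (hf : ∀ᵐ x ∂(volume.restrict (Ioo 0 ℓ)), f x = f' x)
    (hg : ∀ᵐ x ∂(volume.restrict (Ioo 0 ℓ)), g x = g' x) : HasWeakDeriv ℓ f' g' := by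
  refine ⟨h.1.congr hf, h.2.1.congr hg, fun φ hφ hc hs => ?_⟩
  have e₁ : ∫ x in Ioo 0 ℓ, f' x * deriv φ x = ∫ x in Ioo 0 ℓ, f x * deriv φ x :=
    integral_congr_ae (by filter_upwards [hf] with x hx; rw [hx])
  have e₂ : ∫ x in Ioo 0 ℓ, g' x * φ x = ∫ x in Ioo 0 ℓ, g x * φ x :=
    integral_congr_ae (by filter_upwards [hg] with x hx; rw [hx])
  rw [e₁, e₂, h.2.2 φ hφ hc hs]

theorem hasWeakDeriv_weakDeriv {ℓ : ℝ} {f g : ℝ → ℝ} (h : HasWeakDeriv ℓ f g) :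
    HasWeakDeriv ℓ f (weakDeriv ℓ f) := by
  have h' : ∃ g, HasWeakDeriv ℓ f g := ⟨g, h⟩
  unfold weakDeriv
  rw [dif_pos h']
  exact h'.choose_spec

theorem Continuous.integrableOn_Ioo_real {f : ℝ → ℝ} (hf : Continuous f) (a b : ℝ) :
    IntegrableOn f (Ioo a b) :=
  (hf.integrableOn_Icc (a := a) (b := b)).mono_set Ioo_subset_Icc_self

/-- Classical derivatives are weak derivatives. -/
theorem hasWeakDeriv_of_hasDerivAt {ℓ : ℝ} (hℓ : 0 ≤ ℓ) {f g : ℝ → ℝ} (hf : Continuous f)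
    (hg : Continuous g) (h : ∀ x ∈ Ioo 0 ℓ, HasDerivAt f (g x) x) : HasWeakDeriv ℓ f g := by
  refine ⟨hf.integrableOn_Ioo_real _ _, hg.integrableOn_Ioo_real _ _, fun φ hφ hc hs => ?_⟩
  have h0 : φ 0 = 0 := image_eq_zero_of_notMem_tsupport fun h => lt_irrefl _ (hs h).1
  have hl : φ ℓ = 0 := image_eq_zero_of_notMem_tsupport fun h => lt_irrefl _ (hs h).2
  rw [← integral_Ioc_eq_integral_Ioo, ← integral_Ioc_eq_integral_Ioo,
    ← intervalIntegral.integral_of_le hℓ, ← intervalIntegral.integral_of_le hℓ,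
    intervalIntegral.integral_mul_deriv_eq_deriv_mul_of_hasDerivAt (u' := g) (v := φ)
      hf.continuousOn hφ.continuous.continuousOn, h0, hl]
  · ring
  · simpa [hℓ] using h
  · exact fun x _ => (hφ.differentiable (by simp) x).hasDerivAt
  · exact hg.intervalIntegrable _ _
  · exact (hφ.continuous_deriv (by simp)).intervalIntegrable _ _

/-- A smooth function of zero mean supported in `(0, ℓ)` has a primitive supported in `(0, ℓ)`. -/
theorem exists_primitive_tsupport_subset {ℓ : ℝ} (hℓ : 0 < ℓ) {χ : ℝ → ℝ} (hχ : ContDiff ℝ ∞ χ)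
    (hs : tsupport χ ⊆ Ioo 0 ℓ) (hc : HasCompactSupport χ) (h0 : ∫ x in (0 : ℝ)..ℓ, χ x = 0) :
    ∃ φ : ℝ → ℝ, ContDiff ℝ ∞ φ ∧ HasCompactSupport φ ∧ tsupport φ ⊆ Ioo 0 ℓ ∧ deriv φ = χ := by
  have hab : ∃ a b, 0 < a ∧ b < ℓ ∧ tsupport χ ⊆ Icc a b := by
    rcases (tsupport χ).eq_empty_or_nonempty with he | hne
    · exact ⟨ℓ / 2, ℓ / 2, by linarith, by linarith, by simp [he]⟩
    · refine ⟨_, _, (hs (hc.isCompact.sInf_mem hne)).1, (hs (hc.isCompact.sSup_mem hne)).2, ?_⟩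
      exact fun x hx => ⟨csInf_le hc.isCompact.bddBelow hx, le_csSup hc.isCompact.bddAbove hx⟩
  obtain ⟨a, b, ha, hb, hsab⟩ := hab
  have hz : ∀ x, x ∉ Icc a b → χ x = 0 := fun x hx =>
    image_eq_zero_of_notMem_tsupport fun h => hx (hsab h)
  have hd : ∀ x, HasDerivAt (fun u => ∫ t in (0 : ℝ)..u, χ t) (χ x) x := fun x =>
    intervalIntegral.integral_hasDerivAt_right (hχ.continuous.intervalIntegrable _ _)
      hχ.continuous.stronglyMeasurable.stronglyMeasurableAtFilter hχ.continuous.continuousAt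
  have hderiv : deriv (fun u => ∫ t in (0 : ℝ)..u, χ t) = χ := funext fun x => (hd x).deriv
  have hsupp : tsupport (fun u => ∫ t in (0 : ℝ)..u, χ t) ⊆ Icc a b := by
    refine closure_minimal (fun x hx => ?_) isClosed_Icc
    by_contra hxab
    refine hx ?_
    rw [mem_Icc, not_and_or, not_le, not_le] at hxab
    rcases hxab with hxa | hxb
    · refine (intervalIntegral.integral_congr (g := fun _ => (0 : ℝ)) fun t ht => ?_).trans
        (by simp)
      refine hz t fun h => ?_
      have := ht.2
      have h2 : max 0 x < a := max_lt ha hxa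
      linarith [h.1]
    · have hsplit := intervalIntegral.integral_add_adjacent_intervals
        (hχ.continuous.intervalIntegrable (μ := volume) 0 ℓ)
        (hχ.continuous.intervalIntegrable (μ := volume) ℓ x)
      have hlx : ∫ t in ℓ..x, χ t = 0 := by
        refine (intervalIntegral.integral_congr (g := fun _ => (0 : ℝ)) fun t ht => ?_).trans
          (by simp)
        refine hz t fun h => ?_
        have := ht.1
        have h2 : b < min ℓ x := lt_min hb hxb
        linarith [h.2]
      change ∫ t in (0 : ℝ)..x, χ t = 0
      rw [← hsplit, h0, hlx, add_zero]
  refine ⟨fun u => ∫ t in (0 : ℝ)..u, χ t, ?_, ?_, ?_, hderiv⟩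
  · rw [contDiff_infty_iff_deriv, hderiv]
    exact ⟨fun x => (hd x).differentiableAt, hχ⟩
  · exact isCompact_Icc.of_isClosed_subset (isClosed_tsupport _) hsupp
  · exact hsupp.trans (Icc_subset_Ioo ha hb)

/-- The du Bois-Reymond lemma: a function with zero weak derivative is constant. -/
theorem ae_eq_const_of_hasWeakDeriv_zero {ℓ : ℝ} (hℓ : 0 < ℓ) {f : ℝ → ℝ}
    (hf : HasWeakDeriv ℓ f 0) : ∃ c, ∀ᵐ x ∂(volume.restrict (Ioo 0 ℓ)), f x = c := by
  let ψb : ContDiffBump (ℓ / 2) := ⟨ℓ / 8, ℓ / 4, by linarith, by linarith⟩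
  let ψ : ℝ → ℝ := ψb.normed volume
  have hψ : ContDiff ℝ ∞ ψ := ψb.contDiff_normed
  have hψc : HasCompactSupport ψ := ψb.hasCompactSupport_normed
  have hψs : tsupport ψ ⊆ Ioo 0 ℓ := by
    change tsupport (ψb.normed volume) ⊆ _
    rw [ψb.tsupport_normed_eq, Real.closedBall_eq_Icc]
    exact Icc_subset_Ioo (by change 0 < ℓ / 2 - ℓ / 4; linarith)
      (by change ℓ / 2 + ℓ / 4 < ℓ; linarith)
  have hint : ∀ χ : ℝ → ℝ, tsupport χ ⊆ Ioo 0 ℓ → ∫ x in (0 : ℝ)..ℓ, χ x = ∫ x, χ x := by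
    intro χ hχ
    rw [intervalIntegral.integral_of_le hℓ.le, integral_Ioc_eq_integral_Ioo]
    simpa using setIntegral_mul_eq_integral_of_tsupport_subset (f := 1) hχ
  have hψ1 : ∫ x in (0 : ℝ)..ℓ, ψ x = 1 := (hint ψ hψs).trans ψb.integral_normed
  refine ⟨∫ x in Ioo 0 ℓ, f x * ψ x, ?_⟩
  set c := ∫ x in Ioo 0 ℓ, f x * ψ x with hcdef
  have hfc : IntegrableOn (fun x => f x - c) (Ioo 0 ℓ) :=
    hf.1.sub (continuous_const.integrableOn_Ioo_real _ _)
  rw [ae_restrict_iff' measurableSet_Ioo]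
  have key := isOpen_Ioo.ae_eq_zero_of_integral_contDiff_smul_eq_zero (U := Ioo 0 ℓ)
    (μ := volume) (f := fun x => f x - c) hfc.locallyIntegrableOn ?_
  · filter_upwards [key] with x hx hxU using sub_eq_zero.1 (hx hxU)
  · intro χ hχ hχc hχs
    -- Since `ψ` has mass one, `χ - m ψ` has zero mean, so it is the derivative of a test function
    -- and may be tested against `f`.
    set m := ∫ x in (0 : ℝ)..ℓ, χ x with hm
    obtain ⟨φ, hφ, hφc, hφs, hφd⟩ := exists_primitive_tsupport_subset hℓ
      (χ := fun x => χ x - m * ψ x) (hχ.sub (contDiff_const.mul hψ))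
      ((tsupport_sub _ _).trans (union_subset hχs ((tsupport_mul_subset_right).trans hψs)))
      (hχc.sub hψc.mul_left) (by
        rw [intervalIntegral.integral_sub (hχ.continuous.intervalIntegrable _ _)
          ((hψ.continuous.intervalIntegrable _ _).const_mul _),
          intervalIntegral.integral_const_mul, hψ1, mul_one, sub_self])
    have e := hf.2.2 φ hφ hφc hφs
    rw [hφd] at e
    obtain ⟨C, hC⟩ := hχ.continuous.bounded_above_of_compact_support hχc
    obtain ⟨D, hD⟩ := hψ.continuous.bounded_above_of_compact_support hψc
    have i₁ : Integrable (fun x => f x * χ x) (volume.restrict (Ioo 0 ℓ)) :=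
      hf.1.mul_bdd hχ.continuous.aestronglyMeasurable (.of_forall hC)
    have i₂ : Integrable (fun x => f x * ψ x) (volume.restrict (Ioo 0 ℓ)) :=
      hf.1.mul_bdd hψ.continuous.aestronglyMeasurable (.of_forall hD)
    have i₃ : Integrable χ (volume.restrict (Ioo 0 ℓ)) :=
      hχ.continuous.integrableOn_Ioo_real _ _
    have e₂ : ∫ x in Ioo 0 ℓ, f x * (χ x - m * ψ x) =
        (∫ x in Ioo 0 ℓ, f x * χ x) - m * c := by
      rw [hcdef, ← integral_const_mul, ← integral_sub i₁ (i₂.const_mul m)]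
      exact integral_congr_ae (.of_forall fun x => by ring)
    rw [← setIntegral_mul_eq_integral_of_tsupport_subset hχs]
    have e₃ : ∫ x in Ioo 0 ℓ, (f x - c) * χ x = (∫ x in Ioo 0 ℓ, f x * χ x) - c * m := by
      rw [hm, intervalIntegral.integral_of_le hℓ.le, integral_Ioc_eq_integral_Ioo,
        ← integral_const_mul, ← integral_sub i₁ (i₃.const_mul c)]
      exact integral_congr_ae (.of_forall fun x => by ring)
    rw [e₃]
    rw [e₂] at e
    simp only [Pi.zero_apply, zero_mul, integral_zero, neg_zero] at e
    linarith

/-- A function with a continuous weak derivative is almost everywhere a primitive of it. -/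
theorem HasWeakDeriv.exists_ae_eq_integral {ℓ : ℝ} (hℓ : 0 < ℓ) {f g : ℝ → ℝ}
    (h : HasWeakDeriv ℓ f g) (hg : Continuous g) :
    ∃ c, ∀ᵐ x ∂(volume.restrict (Ioo 0 ℓ)), f x = c + ∫ t in (0 : ℝ)..x, g t := by
  have hd : ∀ x, HasDerivAt (fun u => ∫ t in (0 : ℝ)..u, g t) (g x) x := fun x =>
    intervalIntegral.integral_hasDerivAt_right (hg.intervalIntegrable _ _)
      hg.stronglyMeasurable.stronglyMeasurableAtFilter hg.continuousAt
  have hG : HasWeakDeriv ℓ (fun u => ∫ t in (0 : ℝ)..u, g t) g :=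
    hasWeakDeriv_of_hasDerivAt hℓ.le (continuous_iff_continuousAt.2 fun x => (hd x).continuousAt)
      hg fun x _ => hd x
  obtain ⟨c, hc⟩ := ae_eq_const_of_hasWeakDeriv_zero hℓ
    (f := fun x => f x - ∫ t in (0 : ℝ)..x, g t)
    ⟨h.1.sub hG.1, integrable_zero _ _ _, fun φ hφ hφc hφs => by
      obtain ⟨C, hC⟩ := (hφ.continuous_deriv (by simp)).bounded_above_of_compact_support hφc.deriv
      have hm := (hφ.continuous_deriv (by simp)).aestronglyMeasurable
        (μ := volume.restrict (Ioo 0 ℓ))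
      have i₁ := h.1.mul_bdd hm (.of_forall hC)
      have i₂ := hG.1.mul_bdd hm (.of_forall hC)
      have e₁ := h.2.2 φ hφ hφc hφs
      have e₂ := hG.2.2 φ hφ hφc hφs
      simp_rw [sub_mul]
      rw [integral_sub i₁ i₂, e₁, e₂]
      simp⟩
  exact ⟨c, by filter_upwards [hc] with x hx; linarith⟩

/-! ### Riccati equations: comparison and global existence. -/

/-- A backward barrier: a function that is nonpositive at the right endpoint and has nonnegative
derivative wherever it is positive is nonpositive. -/
theorem nonpos_of_right_endpoint_nonpos {ℓ : ℝ} {w w' : ℝ → ℝ}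
    (hw : ∀ t ∈ Icc 0 ℓ, HasDerivWithinAt w (w' t) (Icc 0 ℓ) t) (hl : w ℓ ≤ 0)
    (hpos : ∀ t ∈ Icc 0 ℓ, 0 < w t → 0 ≤ w' t) : ∀ t ∈ Icc 0 ℓ, w t ≤ 0 := by
  intro t ht
  by_contra! hwt
  have hcont : ContinuousOn w (Icc t ℓ) := fun x hx =>
    (hw x ⟨ht.1.trans hx.1, hx.2⟩).continuousWithinAt.mono (Icc_subset_Icc_left ht.1)
  have hS : IsCompact (Icc t ℓ ∩ w ⁻¹' Iic 0) :=
    isCompact_Icc.of_isClosed_subset (hcont.preimage_isClosed_of_isClosed isClosed_Icc isClosed_Iic)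
      inter_subset_left
  -- Let `s` be the first point after `t` with `w ≤ 0`. Before it `w` is positive, hence
  -- nondecreasing, which forces `w t ≤ w s ≤ 0`.
  obtain ⟨s, ⟨hs, hws⟩, hmin⟩ := hS.exists_isLeast ⟨ℓ, ⟨ht.2, le_rfl⟩, hl⟩
  have hder : ∀ x ∈ Ioo t s, HasDerivAt w (w' x) x := fun x hx =>
    (hw x ⟨ht.1.trans hx.1.le, hx.2.le.trans hs.2⟩).hasDerivAt
      (Icc_mem_nhds (ht.1.trans_lt hx.1) (hx.2.trans_le hs.2))
  have hmono : MonotoneOn w (Icc t s) := by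
    refine monotoneOn_of_deriv_nonneg (convex_Icc _ _) (hcont.mono (Icc_subset_Icc_right hs.2))
      ?_ ?_ <;> rw [interior_Icc]
    · exact fun x hx => (hder x hx).differentiableAt.differentiableWithinAt
    · intro x hx
      rw [(hder x hx).deriv]
      refine hpos x ⟨ht.1.trans hx.1.le, hx.2.le.trans hs.2⟩ ?_
      by_contra! hle
      exact absurd (hmin ⟨⟨hx.1.le, hx.2.le.trans hs.2⟩, hle⟩) (not_le.2 hx.2)
  have := hmono (left_mem_Icc.2 hs.1) (right_mem_Icc.2 hs.1) hs.1
  simp only [mem_preimage, mem_Iic] at hws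
  linarith

theorem exists_continuous_eqOn_Icc {a b : ℝ} (hab : a ≤ b) {f : ℝ → ℝ}
    (hf : ContinuousOn f (Icc a b)) : ∃ F : ℝ → ℝ, Continuous F ∧ EqOn F f (Icc a b) :=
  ⟨IccExtend hab ((Icc a b).domRestrict f), hf.domRestrict.Icc_extend', fun t ht => by
    rw [IccExtend_of_mem hab _ ht, domRestrict_apply]⟩

/-- Clamping to `[0, C]` makes the quadratic term of the Riccati equation bounded and globally
Lipschitz, so Picard–Lindelöf reaches across all of `[0, ℓ]`. -/
theorem abs_sq_clamp_sub_le {C : ℝ} (hC : 0 ≤ C) (y z : ℝ) :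
    |max 0 (min y C) ^ 2 - max 0 (min z C) ^ 2| ≤ 2 * C * |y - z| := by
  have h₁ : |max 0 (min y C) - max 0 (min z C)| ≤ |y - z| := by
    refine (abs_max_sub_max_le_max _ _ _ _).trans (max_le (by simp) ?_)
    refine (abs_min_sub_min_le_max _ _ _ _).trans (max_le le_rfl (by simp))
  have h₂ : |max 0 (min y C) + max 0 (min z C)| ≤ 2 * C := by
    rw [abs_of_nonneg (add_nonneg (le_max_left _ _) (le_max_left _ _))]
    have := max_le hC (min_le_right y C)
    have := max_le hC (min_le_right z C)
    linarith
  rw [sq_sub_sq, abs_mul]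
  exact mul_le_mul h₂ h₁ (abs_nonneg _) (by linarith)

/-- The Riccati equation `q' = q² / A - h` with `A > 0`, `h ≥ 0` and nonnegative final value has a
nonnegative solution on `[0, ℓ]`. -/
theorem exists_riccati_solution {ℓ : ℝ} (hℓ : 0 ≤ ℓ) {A h : ℝ → ℝ} (hA : Continuous A)
    (hApos : ∀ x, 0 < A x) (hh : Continuous h) (hh0 : ∀ x, 0 ≤ h x) {b : ℝ} (hb : 0 ≤ b) :
    ∃ q : ℝ → ℝ, Continuous q ∧ q ℓ = b ∧ (∀ t ∈ Icc 0 ℓ, 0 ≤ q t) ∧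
      ∀ t ∈ Icc 0 ℓ, HasDerivWithinAt q (q t ^ 2 / A t - h t) (Icc 0 ℓ) t := by
  have hAi : Continuous fun x => (A x)⁻¹ := hA.inv₀ fun x => (hApos x).ne'
  obtain ⟨C₁, hC₁⟩ := (isCompact_Icc (a := 0) (b := ℓ)).bddAbove_image
    (hA.mul hh).continuousOn
  obtain ⟨D, hD⟩ := (isCompact_Icc (a := 0) (b := ℓ)).bddAbove_image hAi.continuousOn
  obtain ⟨H, hH⟩ := (isCompact_Icc (a := 0) (b := ℓ)).bddAbove_image hh.continuousOn
  simp only [mem_upperBounds, forall_mem_image] at hC₁ hD hH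
  have hmem : ℓ ∈ Icc 0 ℓ := ⟨hℓ, le_rfl⟩
  have hD0 : 0 ≤ D := (inv_nonneg.2 (hApos ℓ).le).trans (hD hmem)
  have hH0 : 0 ≤ H := (hh0 ℓ).trans (hH hmem)
  have hC₁0 : 0 ≤ C₁ := (mul_nonneg (hApos ℓ).le (hh0 ℓ)).trans (hC₁ hmem)
  -- `C` exceeds the final value `b`, and `C ≥ 1` gives `C² ≥ C ≥ A h`. Thus the clamped field is
  -- nonnegative above `C`, the constant `C` is an upper barrier, and the clamp is never active on
  -- the solution.
  obtain ⟨C, hCdef⟩ : ∃ C, C = b + C₁ + 1 := ⟨_, rfl⟩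
  have hC0 : 0 ≤ C := by linarith
  let c : ℝ → ℝ := fun y => max 0 (min y C)
  have hc0 : ∀ y, 0 ≤ c y := fun y => le_max_left _ _
  have hcC : ∀ y, c y ≤ C := fun y => max_le hC0 (min_le_right _ _)
  let f : ℝ → ℝ → ℝ := fun t y => c y ^ 2 * (A t)⁻¹ - h t
  have hL0 : 0 ≤ C ^ 2 * D + H := by positivity
  have hPL : IsPicardLindelof f (tmin := 0) (tmax := ℓ) ⟨ℓ, hmem⟩ b
      (⟨C ^ 2 * D + H, hL0⟩ * ⟨ℓ, hℓ⟩) 0 ⟨C ^ 2 * D + H, hL0⟩ ⟨2 * C * D, by positivity⟩ := by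
    refine ⟨fun t ht => ?_, fun x _ => ?_, fun t ht x _ => ?_, ?_⟩
    · refine LipschitzOnWith.of_dist_le_mul fun y _ z _ => ?_
      rw [Real.dist_eq, Real.dist_eq]
      change |(c y ^ 2 * (A t)⁻¹ - h t) - (c z ^ 2 * (A t)⁻¹ - h t)| ≤ 2 * C * D * |y - z|
      have e : (c y ^ 2 * (A t)⁻¹ - h t) - (c z ^ 2 * (A t)⁻¹ - h t) =
          (c y ^ 2 - c z ^ 2) * (A t)⁻¹ := by ring
      rw [e, abs_mul, abs_of_pos (inv_pos.2 (hApos t))]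
      calc |c y ^ 2 - c z ^ 2| * (A t)⁻¹ ≤ (2 * C * |y - z|) * D :=
            mul_le_mul (abs_sq_clamp_sub_le hC0 y z) (hD ht) (inv_nonneg.2 (hApos t).le)
              (by positivity)
        _ = 2 * C * D * |y - z| := by ring
    · exact ((continuous_const.mul hAi).sub hh).continuousOn
    · change |c x ^ 2 * (A t)⁻¹ - h t| ≤ C ^ 2 * D + H
      have h₁ : c x ^ 2 * (A t)⁻¹ ≤ C ^ 2 * D :=
        mul_le_mul (pow_le_pow_left₀ (hc0 x) (hcC x) 2) (hD ht) (inv_nonneg.2 (hApos t).le)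
          (by positivity)
      have h₂ : 0 ≤ c x ^ 2 * (A t)⁻¹ := mul_nonneg (sq_nonneg _) (inv_nonneg.2 (hApos t).le)
      have h₃ := hH ht
      have h₄ := hh0 t
      rw [abs_le]
      constructor <;> nlinarith [mul_nonneg (sq_nonneg C) hD0]
    · simp only [sub_self, sub_zero, max_eq_right hℓ, NNReal.coe_zero]
      exact le_rfl
  obtain ⟨q, hqℓ, hq⟩ := hPL.exists_eq_forall_mem_Icc_hasDerivWithinAt₀
  change q ℓ = b at hqℓ
  have hnonneg : ∀ t ∈ Icc 0 ℓ, 0 ≤ q t := by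
    have := nonpos_of_right_endpoint_nonpos (w := fun t => -q t) (fun t ht => (hq t ht).neg)
      (by simpa [hqℓ] using hb) (fun t ht hpos => by
        have hc : c (q t) = 0 := max_eq_left ((min_le_left _ _).trans (by linarith))
        simp only [f, hc]
        simpa using hh0 t)
    exact fun t ht => by simpa using this t ht
  have hle : ∀ t ∈ Icc 0 ℓ, q t ≤ C := by
    have := nonpos_of_right_endpoint_nonpos (w := fun t => q t - C)
      (fun t ht => (hq t ht).sub_const C) (by simp only [hqℓ]; linarith) (fun t ht hpos => by
        have hc : c (q t) = C := by
          change max 0 (min (q t) C) = C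
          rw [min_eq_right (by linarith), max_eq_right hC0]
        simp only [f, hc]
        have h₁ : A t * h t ≤ C ^ 2 := (hC₁ ht).trans (by nlinarith)
        rw [sub_nonneg, ← div_eq_mul_inv, le_div_iff₀ (hApos t)]
        linarith)
    exact fun t ht => by simpa using this t ht
  obtain ⟨Q, hQ, heq⟩ := exists_continuous_eqOn_Icc hℓ
    (fun t ht => (hq t ht).continuousWithinAt : ContinuousOn q (Icc 0 ℓ))
  refine ⟨Q, hQ, (heq hmem).trans hqℓ, fun t ht => (heq ht).symm ▸ hnonneg t ht,
    fun t ht => ?_⟩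
  have hc : c (q t) = q t := by
    change max 0 (min (q t) C) = q t
    rw [min_eq_left (hle t ht), max_eq_right (hnonneg t ht)]
  have := (hq t ht).congr_of_mem heq ht
  simpa only [f, hc, heq ht, div_eq_mul_inv] using this

/-- A backward subsolution of the Riccati equation bounds a nonnegative solution from below. -/
theorem le_riccati_solution {ℓ : ℝ} {A h q p p' : ℝ → ℝ} (hApos : ∀ x, 0 < A x)
    (hq0 : ∀ t ∈ Icc 0 ℓ, 0 ≤ q t)
    (hq : ∀ t ∈ Icc 0 ℓ, HasDerivWithinAt q (q t ^ 2 / A t - h t) (Icc 0 ℓ) t)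
    (hp : ∀ t ∈ Icc 0 ℓ, HasDerivWithinAt p (p' t) (Icc 0 ℓ) t)
    (hpp : ∀ t ∈ Icc 0 ℓ, p t ^ 2 / A t - h t ≤ p' t) (hl : p ℓ ≤ q ℓ) :
    ∀ t ∈ Icc 0 ℓ, p t ≤ q t := by
  have := nonpos_of_right_endpoint_nonpos (w := fun t => p t - q t)
    -- Nonnegativity of `q` matters here: where `p > q ≥ 0`, also `p² ≥ q²`, whence `p' ≥ q'`.
    (fun t ht => (hp t ht).sub (hq t ht)) (by linarith) (fun t ht hpos => by
      have h₁ : q t ^ 2 / A t ≤ p t ^ 2 / A t :=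
        div_le_div_of_nonneg_right (pow_le_pow_left₀ (hq0 t ht) (by linarith) 2) (hApos t).le
      linarith [hpp t ht])
  exact fun t ht => by simpa using this t ht

/-! ### Reduction of the fin equation to the Riccati equation. -/

theorem Continuous.memLp_restrict_Ioo {f : ℝ → ℝ} (hf : Continuous f) (p : ℝ≥0∞) (a b : ℝ) :
    MemLp f p (volume.restrict (Ioo a b)) := by
  obtain ⟨C, hC⟩ := (isCompact_Icc (a := a) (b := b)).exists_bound_of_continuousOn hf.continuousOn
  refine MemLp.of_bound hf.aestronglyMeasurable C ?_
  filter_upwards [ae_restrict_mem measurableSet_Ioo] with x hx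
  exact hC x (Ioo_subset_Icc_self hx)

theorem memSobolev_of_hasDerivAt {ℓ : ℝ} (hℓ : 0 ≤ ℓ) (p : ℝ≥0∞) {f g : ℝ → ℝ}
    (hg : Continuous g) (h : ∀ x, HasDerivAt f (g x) x) : MemSobolev p ℓ f := by
  have hf : Continuous f := continuous_iff_continuousAt.2 fun x => (h x).continuousAt
  exact ⟨hf.continuousOn, hf.memLp_restrict_Ioo _ _ _, g, hg.memLp_restrict_Ioo _ _ _,
    hasWeakDeriv_of_hasDerivAt hℓ hf hg fun x _ => h x⟩

theorem weakDeriv_ae_eq_of_hasDerivAt {ℓ : ℝ} (hℓ : 0 ≤ ℓ) {f g : ℝ → ℝ}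
    (hg : Continuous g) (h : ∀ x, HasDerivAt f (g x) x) :
    ∀ᵐ x ∂(volume.restrict (Ioo 0 ℓ)), weakDeriv ℓ f x = g x := by
  have hw : HasWeakDeriv ℓ f g := hasWeakDeriv_of_hasDerivAt hℓ
    (continuous_iff_continuousAt.2 fun x => (h x).continuousAt) hg fun x _ => h x
  exact (hasWeakDeriv_weakDeriv hw).ae_eq hw

theorem Continuous.hasDerivAt_integral {f : ℝ → ℝ} (hf : Continuous f) (a x : ℝ) :
    HasDerivAt (fun u => ∫ t in a..u, f t) (f x) x :=
  intervalIntegral.integral_hasDerivAt_right (hf.intervalIntegrable _ _)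
    hf.stronglyMeasurable.stronglyMeasurableAtFilter hf.continuousAt

section Fin

variable {ℓ β βr Td Tinf : ℝ} {a a' q : ℝ → ℝ}

/-- A solution of the Riccati equation yields a solution of the fin equation. -/
theorem exists_isTemperature_of_riccati (hℓ : 0 < ℓ) (ha : ∀ x, HasDerivAt a (a' x) x)
    (ha' : Continuous a') (hpos : ∀ x, 0 < a x) (hqc : Continuous q) (hqℓ : q ℓ = βr * a ℓ ^ 2)
    (hq : ∀ t ∈ Icc 0 ℓ, HasDerivWithinAt q
      (q t ^ 2 / a t ^ 2 - β * (a t * √(1 + a' t ^ 2))) (Icc 0 ℓ) t) :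
    ∃ T, IsTemperature ℓ β βr Td Tinf a T := by
  have hac : Continuous a := continuous_iff_continuousAt.2 fun x => (ha x).continuousAt
  have hne : ∀ x, a x ^ 2 ≠ 0 := fun x => (pow_pos (hpos x) 2).ne'
  have hr : Continuous fun x => q x / a x ^ 2 := hqc.div (hac.pow 2) hne
  -- This inverts the substitution: `θ = T - Tinf` solves `a² θ' = -q θ`, and the Riccati equation
  -- then gives `(a² θ')' = β a √(1 + a'²) θ`.
  let θ : ℝ → ℝ := fun x => (Td - Tinf) * Real.exp (-∫ t in (0 : ℝ)..x, q t / a t ^ 2)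
  have hθ : ∀ x, HasDerivAt θ (-(q x / a x ^ 2) * θ x) x := fun x => by
    have := ((hr.hasDerivAt_integral 0 x).neg.exp).const_mul (Td - Tinf)
    refine this.congr_deriv ?_
    simp only [θ, Pi.neg_apply]
    ring
  have hθc : Continuous θ := continuous_iff_continuousAt.2 fun x => (hθ x).continuousAt
  have hT : ∀ x, HasDerivAt (fun x => Tinf + θ x) (-(q x / a x ^ 2) * θ x) x :=
    fun x => (hθ x).const_add Tinf
  have hT'c : Continuous fun x => -(q x / a x ^ 2) * θ x := hr.neg.mul hθc
  refine ⟨fun x => Tinf + θ x, memSobolev_of_hasDerivAt hℓ.le 2 hT'c hT, ?_, ?_, ?_⟩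
  · have hflux : HasWeakDeriv ℓ (fun x => -(q x * θ x))
        (fun x => β * (a x * √(1 + a' x ^ 2)) * θ x) := by
      refine hasWeakDeriv_of_hasDerivAt hℓ.le (hqc.mul hθc).neg (by fun_prop) fun x hx => ?_
      have hqx := (hq x (Ioo_subset_Icc_self hx)).hasDerivAt (Icc_mem_nhds hx.1 hx.2)
      refine ((hqx.mul (hθ x)).neg).congr_deriv ?_
      ring
    refine hflux.congr_ae ?_ ?_
    · filter_upwards [weakDeriv_ae_eq_of_hasDerivAt hℓ.le hT'c hT] with x hx
      rw [hx]
      have := (hpos x).ne'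
      field_simp
    · filter_upwards [weakDeriv_ae_eq_of_hasDerivAt hℓ.le ha' ha] with x hx
      rw [hx]
      ring
  · simp [θ]
  · refine (hT ℓ).hasDerivWithinAt.congr_deriv ?_
    rw [hqℓ]
    have := (hpos ℓ).ne'
    field_simp
    ring

/-- The inlet slope of any solution of the fin equation is determined by the Riccati solution. -/
theorem IsTemperature.derivWithin_inlet_eq (hℓ : 0 < ℓ) (ha : ∀ x, HasDerivAt a (a' x) x)
    (ha' : Continuous a') (hpos : ∀ x, 0 < a x) (hqc : Continuous q) (hqℓ : q ℓ = βr * a ℓ ^ 2)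
    (hq : ∀ t ∈ Icc 0 ℓ, HasDerivWithinAt q
      (q t ^ 2 / a t ^ 2 - β * (a t * √(1 + a' t ^ 2))) (Icc 0 ℓ) t) {T : ℝ → ℝ}
    (hT : IsTemperature ℓ β βr Td Tinf a T) :
    derivWithin T (Icc 0 ℓ) 0 = -(q 0 * (Td - Tinf) / a 0 ^ 2) := by
  have hac : Continuous a := continuous_iff_continuousAt.2 fun x => (ha x).continuousAt
  have hne : ∀ x, a x ^ 2 ≠ 0 := fun x => (pow_pos (hpos x) 2).ne'
  have h0 : (0 : ℝ) ∈ Icc 0 ℓ := ⟨le_rfl, hℓ.le⟩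
  have hl : ℓ ∈ Icc 0 ℓ := ⟨hℓ.le, le_rfl⟩
  -- Regularity by bootstrapping: continuity of `T` makes the flux `a² T'` almost everywhere equal
  -- to a `C¹` function `P`, and then `T` itself is `C¹` on `[0, ℓ]` with derivative `P / a²`.
  obtain ⟨U, hU, hUT⟩ := exists_continuous_eqOn_Icc hℓ.le hT.memSobolev.continuousOn
  let g : ℝ → ℝ := fun x => β * (a x * √(1 + a' x ^ 2)) * (U x - Tinf)
  have hg : Continuous g := by fun_prop
  have hw : HasWeakDeriv ℓ (fun x => a x ^ 2 * weakDeriv ℓ T x) g := by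
    refine hT.equation.congr_ae (.of_forall fun _ => rfl) ?_
    filter_upwards [weakDeriv_ae_eq_of_hasDerivAt hℓ.le ha' ha,
      ae_restrict_mem measurableSet_Ioo] with x hx hxI
    simp only [g, hx, hUT (Ioo_subset_Icc_self hxI)]
  obtain ⟨c, hc⟩ := hw.exists_ae_eq_integral hℓ hg
  let P : ℝ → ℝ := fun x => c + ∫ t in (0 : ℝ)..x, g t
  have hP : ∀ x, HasDerivAt P (g x) x := fun x => (hg.hasDerivAt_integral 0 x).const_add c
  have hPc : Continuous P := continuous_iff_continuousAt.2 fun x => (hP x).continuousAt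
  have hPa : Continuous fun x => P x / a x ^ 2 := hPc.div (hac.pow 2) hne
  obtain ⟨T', -, hT'⟩ := hT.memSobolev.exists_weakDeriv
  have hwT : HasWeakDeriv ℓ T fun x => P x / a x ^ 2 := by
    refine (hasWeakDeriv_weakDeriv hT').congr_ae (.of_forall fun _ => rfl) ?_
    filter_upwards [hc] with x hx
    rw [eq_div_iff (hne x), mul_comm]
    exact hx
  obtain ⟨d, hd⟩ := hwT.exists_ae_eq_integral hℓ hPa
  let S : ℝ → ℝ := fun x => d + ∫ t in (0 : ℝ)..x, P t / a t ^ 2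
  have hS : ∀ x, HasDerivAt S (P x / a x ^ 2) x :=
    fun x => (hPa.hasDerivAt_integral 0 x).const_add d
  have hTS : EqOn T S (Icc 0 ℓ) := by
    refine Measure.eqOn_Icc_of_ae_eq volume hℓ.ne ?_ hT.memSobolev.continuousOn
      fun x _ => (hS x).continuousAt.continuousWithinAt
    rw [← restrict_Ioo_eq_restrict_Icc]
    exact hd
  have hTd : ∀ x ∈ Icc 0 ℓ, HasDerivWithinAt T (P x / a x ^ 2) (Icc 0 ℓ) x := fun x hx =>
    (hS x).hasDerivWithinAt.congr_of_mem hTS hx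
  have hPℓ : P ℓ / a ℓ ^ 2 = -βr * (T ℓ - Tinf) :=
    (uniqueDiffOn_Icc hℓ ℓ hl).eq_deriv _ (hTd ℓ hl) hT.tip
  have hr : Continuous fun x => q x / a x ^ 2 := hqc.div (hac.pow 2) hne
  -- The defect `D = P + q (T - Tinf)` satisfies the linear equation `D' = (q / a²) D`. The
  -- exponential is its integrating factor, and the tip condition makes `D` vanish at `ℓ`, hence
  -- also at `0`.
  let E : ℝ → ℝ := fun x => (P x + q x * (T x - Tinf)) *
    Real.exp (-∫ t in (0 : ℝ)..x, q t / a t ^ 2)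
  have hE : ∀ x ∈ Icc 0 ℓ, HasDerivWithinAt E 0 (Icc 0 ℓ) x := fun x hx => by
    have h₁ := ((hP x).hasDerivWithinAt (s := Icc 0 ℓ)).add
      ((hq x hx).mul ((hTd x hx).sub_const Tinf))
    have h₂ := ((hr.hasDerivAt_integral 0 x).neg.exp).hasDerivWithinAt (s := Icc 0 ℓ)
    refine (h₁.mul h₂).congr_deriv ?_
    simp only [g, hUT hx, Pi.neg_apply, Pi.add_apply, Pi.mul_apply]
    have := hne x
    field_simp
    ring
  have hEℓ : E ℓ = 0 := by
    have : P ℓ + q ℓ * (T ℓ - Tinf) = 0 := by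
      rw [div_eq_iff (hne ℓ)] at hPℓ
      rw [hPℓ, hqℓ]
      ring
    simp only [E, this, zero_mul]
  have hE0 : E 0 = 0 := by
    refine le_antisymm
      (nonpos_of_right_endpoint_nonpos hE hEℓ.le (fun _ _ _ => le_rfl) 0 h0) ?_
    have := nonpos_of_right_endpoint_nonpos (fun x hx => (hE x hx).neg) (by simp [hEℓ])
      (fun _ _ _ => by simp) 0 h0
    simpa using this
  simp only [E, intervalIntegral.integral_same, neg_zero, Real.exp_zero, mul_one, hT.inlet] at hE0
  rw [(hTd 0 h0).derivWithin (uniqueDiffOn_Icc hℓ 0 h0), ← neg_div]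
  congr 1
  linarith

/-- Existence rules out the default value `0` in `heatFlux`, and the slope formula, valid for every
solution, makes the choice of `T` immaterial. -/
theorem heatFlux_eq_of_riccati (k : ℝ) (hℓ : 0 < ℓ) (ha : ∀ x, HasDerivAt a (a' x) x)
    (ha' : Continuous a') (hpos : ∀ x, 0 < a x) (hqc : Continuous q) (hqℓ : q ℓ = βr * a ℓ ^ 2)
    (hq : ∀ t ∈ Icc 0 ℓ, HasDerivWithinAt q
      (q t ^ 2 / a t ^ 2 - β * (a t * √(1 + a' t ^ 2))) (Icc 0 ℓ) t) :
    heatFlux ℓ k β βr Td Tinf a = k * Real.pi * (Td - Tinf) * q 0 := by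
  have h : ∃ T, IsTemperature ℓ β βr Td Tinf a T :=
    exists_isTemperature_of_riccati hℓ ha ha' hpos hqc hqℓ hq
  rw [heatFlux, dif_pos h, h.choose_spec.derivWithin_inlet_eq hℓ ha ha' hpos hqc hqℓ hq]
  have := (hpos 0).ne'
  field_simp

end Fin

/-! ### Steep flares: small volume, large flux. -/

/-- A fin of radius `a₀` with an exponentially steep flare of height `B` at the inlet. -/
noncomputable def flare (a₀ B n x : ℝ) : ℝ := a₀ + B * Real.exp (-(n * x))

theorem hasDerivAt_flare (a₀ B n x : ℝ) :
    HasDerivAt (flare a₀ B n) (-(n * (B * Real.exp (-(n * x))))) x := by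
  have := ((((hasDerivAt_id x).const_mul n).neg.exp).const_mul B).const_add a₀
  refine this.congr_deriv ?_
  simp only [Pi.neg_apply, id]
  ring

theorem continuous_flare (a₀ B n : ℝ) : Continuous (flare a₀ B n) := by
  unfold flare
  fun_prop

/-- On `[0, ℓ]` one has `exp(-2 n x) ≤ exp(-n x)`, and the integral of the latter is at most `1 /
n`. A flare of fixed height therefore costs arbitrarily little volume. -/
theorem finVol_flare_le {a₀ ℓ B n : ℝ} (ha₀ : 0 ≤ a₀) (hℓ : 0 ≤ ℓ) (hB : 0 ≤ B) (hn : 0 < n) :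
    finVol ℓ (flare a₀ B n) ≤ ℓ * a₀ ^ 2 + (2 * a₀ * B + B ^ 2) / n := by
  let G : ℝ → ℝ := fun x => a₀ ^ 2 * x - (2 * a₀ * B + B ^ 2) / n * Real.exp (-(n * x))
  have hG : ∀ x, HasDerivAt G (a₀ ^ 2 + (2 * a₀ * B + B ^ 2) * Real.exp (-(n * x))) x := by
    intro x
    have := ((hasDerivAt_id x).const_mul (a₀ ^ 2)).sub
      ((((hasDerivAt_id x).const_mul n).neg.exp).const_mul ((2 * a₀ * B + B ^ 2) / n))
    refine this.congr_deriv ?_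
    simp only [Pi.neg_apply, id]
    field_simp
    ring
  have hc : Continuous fun x => a₀ ^ 2 + (2 * a₀ * B + B ^ 2) * Real.exp (-(n * x)) := by
    fun_prop
  have hint : ∫ x in (0 : ℝ)..ℓ, (a₀ ^ 2 + (2 * a₀ * B + B ^ 2) * Real.exp (-(n * x))) =
      G ℓ - G 0 :=
    intervalIntegral.integral_eq_sub_of_hasDerivAt (fun x _ => hG x) (hc.intervalIntegrable _ _)
  calc finVol ℓ (flare a₀ B n) = ∫ x in (0 : ℝ)..ℓ, flare a₀ B n x ^ 2 := by
        rw [finVol, intervalIntegral.integral_of_le hℓ, integral_Ioc_eq_integral_Ioo]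
    _ ≤ ∫ x in (0 : ℝ)..ℓ, (a₀ ^ 2 + (2 * a₀ * B + B ^ 2) * Real.exp (-(n * x))) := by
        refine intervalIntegral.integral_mono_on hℓ
          (((continuous_flare a₀ B n).pow 2).intervalIntegrable _ _) (hc.intervalIntegrable _ _)
          fun x hx => ?_
        have h₁ : Real.exp (-(n * x)) ≤ 1 :=
          Real.exp_le_one_iff.2 (neg_nonpos.2 (mul_nonneg hn.le hx.1))
        have h₂ := (Real.exp_pos (-(n * x))).le
        have h₃ : B ^ 2 * (Real.exp (-(n * x)) * Real.exp (-(n * x))) ≤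
            B ^ 2 * (Real.exp (-(n * x)) * 1) := by gcongr
        unfold flare
        nlinarith
    _ = G ℓ - G 0 := hint
    _ ≤ ℓ * a₀ ^ 2 + (2 * a₀ * B + B ^ 2) / n := by
        have : 0 ≤ (2 * a₀ * B + B ^ 2) / n * Real.exp (-(n * ℓ)) := by positivity
        simp only [G, mul_zero, neg_zero, Real.exp_zero, mul_one]
        linarith

theorem flare_mem_volClass {a₀ ℓ V₀ B n : ℝ} (ha₀ : 0 ≤ a₀) (hℓ : 0 ≤ ℓ) (hB : 0 ≤ B)
    (hn : 0 < n) (hV : ℓ * a₀ ^ 2 + (2 * a₀ * B + B ^ 2) / n ≤ V₀) :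
    flare a₀ B n ∈ volClass a₀ ℓ V₀ := by
  refine ⟨memSobolev_of_hasDerivAt hℓ _ (by fun_prop) (hasDerivAt_flare a₀ B n),
    .of_forall fun x => ?_, (finVol_flare_le ha₀ hℓ hB hn).trans hV⟩
  exact le_add_of_nonneg_right (by positivity)

/-- The flux through a steep flare is bounded below by a multiple of its lateral area. -/
theorem le_heatFlux_flare {ℓ k β βr Td Tinf a₀ B n : ℝ} (hk : 0 < k) (hβ : 0 < β)
    (hβr : 0 ≤ βr) (hT : Tinf < Td) (ha₀ : 0 < a₀) (hℓ : 0 < ℓ) (hB : 0 ≤ B) (hn : 0 < n)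
    (hβn : β ≤ 2 * n) :
    k * Real.pi * (Td - Tinf) * (β / 4 * (flare a₀ B n 0 ^ 2 - flare a₀ B n ℓ ^ 2)) ≤
      heatFlux ℓ k β βr Td Tinf (flare a₀ B n) := by
  have ha := hasDerivAt_flare a₀ B n
  have hac := continuous_flare a₀ B n
  have hu : ∀ x, 0 ≤ B * Real.exp (-(n * x)) := fun x => by positivity
  have hpos : ∀ x, 0 < flare a₀ B n x := fun x => add_pos_of_pos_of_nonneg ha₀ (hu x)
  have ha' : Continuous fun x => -(n * (B * Real.exp (-(n * x)))) := by fun_prop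
  obtain ⟨q, hqc, hqℓ, hq0, hq⟩ := exists_riccati_solution hℓ.le (hac.pow 2)
    (fun x => pow_pos (hpos x) 2)
    (h := fun t => β * (flare a₀ B n t * √(1 + (-(n * (B * Real.exp (-(n * t))))) ^ 2)))
    (by fun_prop) (fun t => by have := hpos t; positivity)
    (b := βr * flare a₀ B n ℓ ^ 2) (by positivity)
  rw [heatFlux_eq_of_riccati k hℓ ha ha' hpos hqc hqℓ hq]
  have hTT : 0 < Td - Tinf := sub_pos.2 hT
  refine mul_le_mul_of_nonneg_left ?_ (by positivity)
  refine le_riccati_solution (p := fun x => β / 4 * (flare a₀ B n x ^ 2 - flare a₀ B n ℓ ^ 2))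
    (fun x => pow_pos (hpos x) 2) hq0 hq
    (fun t _ => ((((ha t).pow 2).sub_const (flare a₀ B n ℓ ^ 2)).const_mul
      (β / 4)).hasDerivWithinAt) (fun t ht => ?_) ?_ 0 ⟨le_rfl, hℓ.le⟩
  · have hle : flare a₀ B n ℓ ≤ flare a₀ B n t := by
      unfold flare
      gcongr
      exact ht.2
    have hge : a₀ ≤ flare a₀ B n ℓ := le_add_of_nonneg_right (hu ℓ)
    have hdef : flare a₀ B n t = a₀ + B * Real.exp (-(n * t)) := rfl
    have hut := hu t
    have hpt := hpos t
    set u := B * Real.exp (-(n * t))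
    set a := flare a₀ B n t
    set b := flare a₀ B n ℓ
    have hsqrt : n * u ≤ √(1 + (-(n * u)) ^ 2) := Real.le_sqrt_of_sq_le (by nlinarith)
    have hp0 : 0 ≤ β / 4 * (a ^ 2 - b ^ 2) := by
      have : 0 ≤ a ^ 2 - b ^ 2 := by nlinarith
      positivity
    -- Factor `a² - b² = (a - b)(a + b)`, with `a - b ≤ u` because `b ≥ a₀`, and `a + b ≤ 2 a`.
    have hp1 : β / 4 * (a ^ 2 - b ^ 2) ≤ β / 2 * u * a := by
      have : a ^ 2 - b ^ 2 ≤ 2 * u * a := by nlinarith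
      nlinarith
    have hp2 : (β / 4 * (a ^ 2 - b ^ 2)) ^ 2 / a ^ 2 ≤ (β / 2 * u) ^ 2 := by
      rw [div_le_iff₀ (by positivity), ← mul_pow]
      exact pow_le_pow_left₀ hp0 hp1 2
    -- By `β ≤ 2 n`, the quadratic term consumes at most half of the source `β a n u`; the other
    -- half is exactly `-p'`.
    have hp3 : (β / 2 * u) ^ 2 ≤ β / 2 * (n * u) * a := by
      have h₁ : u ≤ a := by linarith
      have h₂ : β * u * u ≤ 2 * n * u * a := by gcongr
      nlinarith
    have hp4 : β * (a * (n * u)) ≤ β * (a * √(1 + (-(n * u)) ^ 2)) := by gcongr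
    refine (sub_le_sub (hp2.trans hp3) hp4).trans (le_of_eq ?_)
    push_cast
    ring
  · simp only [sub_self, mul_zero]
    exact hq0 ℓ ⟨hℓ.le, le_rfl⟩

/-- The heat flux is unbounded on the admissible class. -/
theorem exists_lt_heatFlux {ℓ k β βr Td Tinf a₀ V₀ : ℝ} (hk : 0 < k) (hβ : 0 < β)
    (hβr : 0 ≤ βr) (hT : Tinf < Td) (ha₀ : 0 < a₀) (hℓ : 0 < ℓ) (hV₀ : ℓ * a₀ ^ 2 < V₀) (M : ℝ) :
    ∃ a ∈ volClass a₀ ℓ V₀, M < heatFlux ℓ k β βr Td Tinf a := by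
  have hTT : 0 < Td - Tinf := sub_pos.2 hT
  have hV : 0 < V₀ - ℓ * a₀ ^ 2 := sub_pos.2 hV₀
  obtain ⟨K, hK⟩ : ∃ K, K = k * Real.pi * (Td - Tinf) * β / 8 := ⟨_, rfl⟩
  have hK0 : 0 < K := by rw [hK]; positivity
  -- Chosen so that `K B = K + |M| > M`; the summand `1` also gives `B² ≥ B`.
  obtain ⟨B, hBdef⟩ : ∃ B, B = 1 + |M| / K := ⟨_, rfl⟩
  have hB1 : 1 ≤ B := by
    rw [hBdef]
    exact le_add_of_nonneg_right (by positivity)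
  have hB : 0 ≤ B := by linarith
  -- The three summands secure, in order, `β ≤ 2 n`, decay of the flare to at most half its height
  -- at `ℓ`, and the volume constraint.
  obtain ⟨n, hndef⟩ : ∃ n, n = β + 1 / ℓ + (2 * a₀ * B + B ^ 2) / (V₀ - ℓ * a₀ ^ 2) := ⟨_, rfl⟩
  have h₁ : 0 < 1 / ℓ := by positivity
  have h₂ : 0 ≤ (2 * a₀ * B + B ^ 2) / (V₀ - ℓ * a₀ ^ 2) := by positivity
  have hn : 0 < n := by linarith
  have hnV : (2 * a₀ * B + B ^ 2) / n ≤ V₀ - ℓ * a₀ ^ 2 := by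
    rw [div_le_iff₀ hn, mul_comm (V₀ - _), ← div_le_iff₀ hV]
    linarith
  have hnℓ : 1 ≤ n * ℓ := by
    rw [← div_le_iff₀ hℓ]
    linarith
  have hexp : Real.exp (-(n * ℓ)) ≤ 1 / 2 := by
    rw [Real.exp_neg, inv_le_comm₀ (Real.exp_pos _) (by norm_num)]
    have := Real.add_one_le_exp (n * ℓ)
    norm_num
    linarith
  refine ⟨flare a₀ B n, flare_mem_volClass ha₀.le hℓ.le hB hn (by linarith), ?_⟩
  refine lt_of_lt_of_le ?_
    (le_heatFlux_flare hk hβ hβr hT ha₀ hℓ hB hn (by linarith : β ≤ 2 * n))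
  have harea : B ^ 2 / 2 ≤ flare a₀ B n 0 ^ 2 - flare a₀ B n ℓ ^ 2 := by
    have he := (Real.exp_pos (-(n * ℓ))).le
    simp only [flare, mul_zero, neg_zero, Real.exp_zero, mul_one]
    set e := Real.exp (-(n * ℓ))
    have h₃ : B * e ≤ B / 2 := by nlinarith
    have h₄ : 0 ≤ B * e := by positivity
    nlinarith [mul_nonneg (sub_nonneg.2 h₃) hB, mul_nonneg (sub_nonneg.2 h₃) h₄,
      mul_nonneg (sub_nonneg.2 h₃) ha₀.le, mul_nonneg hB ha₀.le]
  have harea' : B / 2 ≤ flare a₀ B n 0 ^ 2 - flare a₀ B n ℓ ^ 2 := by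
    nlinarith
  calc M ≤ |M| := le_abs_self M
    _ < K * B := by
        rw [hBdef, mul_add, mul_div_cancel₀ _ hK0.ne']
        linarith
    _ = k * Real.pi * (Td - Tinf) * (β / 4 * (B / 2)) := by rw [hK]; ring
    _ ≤ _ := by gcongr

theorem theorem1 (k β βr Td Tinf a₀ ℓ V₀ : ℝ)
    (hk : 0 < k) (hβ : 0 < β) (hβr : 0 ≤ βr) (hTinf : 0 < Tinf) (hTd : Tinf < Td)
    (ha₀ : 0 < a₀) (hℓ : 0 < ℓ) (hV₀ : ℓ * a₀ ^ 2 < V₀) :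
    (¬ ∃ a ∈ volClass a₀ ℓ V₀, ∀ c ∈ volClass a₀ ℓ V₀,
      heatFlux ℓ k β βr Td Tinf c ≤ heatFlux ℓ k β βr Td Tinf a) ∧
    (⨆ a ∈ volClass a₀ ℓ V₀, (heatFlux ℓ k β βr Td Tinf a : EReal)) = ⊤ := by
  constructor
  · rintro ⟨a, -, hmax⟩
    obtain ⟨c, hc, hlt⟩ := exists_lt_heatFlux hk hβ hβr hTd ha₀ hℓ hV₀
      (heatFlux ℓ k β βr Td Tinf a)
    exact absurd (hmax c hc) (not_le.2 hlt)
  · rw [EReal.eq_top_iff_forall_lt]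
    intro M
    obtain ⟨c, hc, hlt⟩ := exists_lt_heatFlux hk hβ hβr hTd ha₀ hℓ hV₀ M
    exact (EReal.coe_lt_coe_iff.2 hlt).trans_le
      (le_iSup₂ (f := fun a (_ : a ∈ volClass a₀ ℓ V₀) =>
        (heatFlux ℓ k β βr Td Tinf a : EReal)) c hc)
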